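/- Let $K$ be a field, let $P$ be a finite poset, let $L$ be the distributive lattice of order ideals (down-closed subsets) of $P$ ordered by inclusion, and let $A$ be the incidence algebra of $L$ over $K$, i.e. the $K$-algebra with basis $p^a_b$ ($a\le b$ in $L$) and multiplication $p^a_b\,p^c_d=p^a_d$ if $b=c$ and $0$ otherwise. For $x\in L$ put $e_x=p^x_x$, and let $P(x)=e_xA$ and $I(x)=\operatorname{Hom}_K(Ae_x,K)$ be the corresponding indecomposable projective and indecomposable injective right $A$-modules. For a finitely generated right $A$-module $M$ with minimal injective coresolution $0\to M\to I^0\to I^1\to\cdots$, the Bass number $\mu^i(x,M)$ is the multiplicity of $I(x)$ as a direct summand of $I^i$. Write $\operatorname{cov}(x)$ for the set of elements of $L$ covering $x$, and $\min(X)$, $\max(X)$ for the sets of minimal and maximal elements of a subset $X\subseteq P$. Then for all $x,y\in L$ and $i\ge 0$, $$\mu^i(x,P(y))=\begin{cases}1 & \text{if } i=|\operatorname{cov}(x)| \text{ and } \min(P\setminus x)\subseteq\max(y),\\ 0 & \text{otherwise,}\end{cases}$$ $$\mu^i(x,A)=\begin{cases}|\{y\in L \mid \min(P\setminus x)\subseteq\max(y)\}|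 & \text{if } i=|\operatorname{cov}(x)|,\\ 0 & \text{otherwise,}\end{cases}$$ where in $\mu^i(x,A)$ the algebra $A$ is regarded as a right module over itself. -/

import Mathlib

universe u v w

namespace BassNumbers

open MulOpposite

section Modules

variable (R : Type u) [Ring R]

/-- A minimal injective coresolution `0 → M → I⁰ → I¹ → ⋯` of the `R`-module `M`: an exact sequence
with all `Iⁱ` injective, in which the image of `M` is an essential submodule of `I⁰` and the image
of `Iⁱ` is an essential submodule of `Iⁱ⁺¹` (so that each term is an injective envelope of the
preceding cokernel). -/
structure MinInjCoresolution (M : Type w) [AddCommGroup M] [Module R M] where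
  /-- the terms -/
  I : ℕ → Type w
  [addCommGroup : ∀ i, AddCommGroup (I i)]
  [module : ∀ i, Module R (I i)]
  /-- the coaugmentation -/
  ι : M →ₗ[R] I 0
  /-- the differentials -/
  d : ∀ i, I i →ₗ[R] I (i + 1)
  injective : ∀ i, Module.Injective R (I i)
  ι_injective : Function.Injective ι
  exact_zero : Function.Exact ι (d 0)
  exact_succ : ∀ i, Function.Exact (d i) (d (i + 1))
  essential_zero : ∀ N : Submodule R (I 0), N ⊓ LinearMap.range ι = ⊥ → N = ⊥
  essential_succ : ∀ i, ∀ N : Submodule R (I (i + 1)), N ⊓ LinearMap.range (d i) = ⊥ → N = ⊥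

attribute [instance] MinInjCoresolution.addCommGroup MinInjCoresolution.module

/-- `X` occurs in `M` with multiplicity `n`: `n` is the largest number such that `Xⁿ` is isomorphic
to a direct summand of `M`. For an indecomposable `X` and a module `M` of finite length this is the
number of summands isomorphic to `X` in a decomposition of `M` into indecomposables
(Krull-Schmidt). -/
def HasMultiplicity (X : Type v) [AddCommGroup X] [Module R X]
    (M : Type w) [AddCommGroup M] [Module R M] (n : ℕ) : Prop :=
  IsGreatest {k : ℕ | ∃ N N' : Submodule R M, IsCompl N N' ∧ Nonempty (N ≃ₗ[R] (Fin k → X))} n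

end Modules

section Incidence

variable (K : Type u) [Field K] {L : Type v} [PartialOrder L] [LocallyFiniteOrder L]
  [DecidableEq L]

/-- The primitive idempotent `e_x` of the incidence algebra. -/
def idem (x : L) : IncidenceAlgebra K L where
  toFun a b := if a = x ∧ b = x then 1 else 0
  eq_zero_of_not_le' a b h := if_neg fun hx => h (by rw [hx.1, hx.2])

/-- The indecomposable projective right module `P(x) = e_x A`. Right `A`-modules are modules over
`Aᵐᵒᵖ`. -/
abbrev projModule (x : L) : Submodule (IncidenceAlgebra K L)ᵐᵒᵖ (IncidenceAlgebra K L) :=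
  Submodule.span (IncidenceAlgebra K L)ᵐᵒᵖ {idem K x}

/-- The left ideal `A e_x`. -/
abbrev leftIdeal (x : L) : Ideal (IncidenceAlgebra K L) :=
  Ideal.span {idem K x}

/-- The indecomposable injective right module `I(x) = D(A e_x) = Hom_K(A e_x, K)`. -/
def InjModule (x : L) : Type (max u v) :=
  leftIdeal K x →ₗ[K] K

instance (x : L) : AddCommGroup (InjModule K x) :=
  inferInstanceAs (AddCommGroup (leftIdeal K x →ₗ[K] K))

/-- The right action of `A` on functionals on `A e_x`: `(φ · a)(m) = φ (a m)`. -/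
def dualAct (x : L) (a : IncidenceAlgebra K L) (φ : leftIdeal K x →ₗ[K] K) :
    leftIdeal K x →ₗ[K] K where
  toFun m := φ (a • m)
  map_add' m m' := by rw [smul_add, map_add]
  map_smul' c m := by rw [smul_comm a c m, map_smul, RingHom.id_apply]

/-- `I(x)` is a right `A`-module. -/
instance (x : L) : Module (IncidenceAlgebra K L)ᵐᵒᵖ (InjModule K x) where
  smul a φ := dualAct K x (unop a) φ
  one_smul φ := LinearMap.ext fun m => congrArg (DFunLike.coe (F := leftIdeal K x →ₗ[K] K) φ)
    (one_smul (IncidenceAlgebra K L) m)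
  mul_smul a b φ := LinearMap.ext fun m =>
    congrArg (DFunLike.coe (F := leftIdeal K x →ₗ[K] K) φ) (mul_smul (unop b) (unop a) m)
  smul_zero _ := rfl
  smul_add _ _ _ := rfl
  add_smul a b φ := LinearMap.ext fun m =>
    (congrArg (DFunLike.coe (F := leftIdeal K x →ₗ[K] K) φ)
      (add_smul (unop a) (unop b) m)).trans (map_add (F := leftIdeal K x →ₗ[K] K) φ _ _)
  zero_smul φ := LinearMap.ext fun m =>
    (congrArg (DFunLike.coe (F := leftIdeal K x →ₗ[K] K) φ)
      (zero_smul (IncidenceAlgebra K L) m)).trans (map_zero (F := leftIdeal K x →ₗ[K] K) φ)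

/-- `μⁱ(x, M) = n`: the right module `M` over the incidence algebra of `L` has a minimal injective
coresolution, and in every minimal injective coresolution of `M` the module `I(x)` occurs in the
`i`-th term with multiplicity `n`. -/
def IsBassNumber (i : ℕ) (x : L) (M : Type (max u v)) [AddCommGroup M]
    [Module (IncidenceAlgebra K L)ᵐᵒᵖ M] (n : ℕ) : Prop :=
  Nonempty (MinInjCoresolution (IncidenceAlgebra K L)ᵐᵒᵖ M) ∧
    ∀ C : MinInjCoresolution (IncidenceAlgebra K L)ᵐᵒᵖ M,
      HasMultiplicity (IncidenceAlgebra K L)ᵐᵒᵖ (InjModule K x) (C.I i) n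

/-- The Bass number is uniquely determined. -/
theorem IsBassNumber.unique {i : ℕ} {x : L} {M : Type (max u v)} [AddCommGroup M]
    [Module (IncidenceAlgebra K L)ᵐᵒᵖ M] {n n' : ℕ} (h : IsBassNumber K i x M n)
    (h' : IsBassNumber K i x M n') : n = n' :=
  h.1.elim fun C => (h.2 C).unique (h'.2 C)

end Incidence

section Posets

/-- The set `cov(x)` of elements that cover `x`. -/
def cov {L : Type v} [PartialOrder L] (x : L) : Set L := {z | x ⋖ z}

/-- The set of minimal elements of `X`. -/
def minSet {P : Type v} [PartialOrder P] (X : Set P) : Set P := {p | Minimal (· ∈ X) p}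

/-- The set of maximal elements of `X`. -/
def maxSet {P : Type v} [PartialOrder P] (X : Set P) : Set P := {p | Maximal (· ∈ X) p}

end Posets

end BassNumbers

namespace BassNumbers

open MulOpposite

/-! ### Uniqueness of minimal injective coresolutions. -/

section Modules

variable {R : Type u} [Ring R]

/-! The minimal injective coresolution of `P(y)` can be written down. In degree `i` it is the sum of
the `I(avoid S)` over the `i`-element subsets `S` of `max(y)`, where `avoid S` is the largest order
ideal disjoint from `S`; the differential is the simplicial coboundary.

Cut down by the idempotent of `w`, the module `I(z)` is `K` if `w ≤ z` and `0` otherwise, so the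
summands present at `w` are the `S ⊆ max(y) \ w`. The complex at `w` is thus the augmented cochain
complex of a full simplex. If `max(y) \ w` is nonempty it is contracted by a cone
(`coneHomotopy_coboundary`). If it is empty, that is if `y ≤ w`, only `S = ∅` survives, which is
`P(y)` at `w`. This gives exactness.

Minimality (`ker_differential_essential`) holds because `max(y)` is an antichain: the socle of
`I(avoid S)` sits at `avoid S`, and no summand `S ∪ {t}` with `t ∉ S` is present there.

An antichain `S` is recovered from `x = avoid S` as `min(P \ x)` (`avoid_eq_iff`). So `I(x)` occurs
at most once, exactly when `min(P \ x) ⊆ max(y)`, and then in degree `|min(P \ x)| = |cov(x)|`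
(`ncard_cov`). Multiplicities are read off from socles (`hasMultiplicity_pi`), and uniqueness of
minimal coresolutions transfers the count to all of them. The algebra is the direct sum of all
`P(y)`, so everything is done for a finite family of ideals. -/

theorem exists_extension_of_ker_le {N : Type*} {I I' : Type w} [AddCommGroup N] [Module R N]
    [AddCommGroup I] [Module R I] [AddCommGroup I'] [Module R I'] [hI' : Module.Injective R I']
    (f : N →ₗ[R] I) (f' : N →ₗ[R] I') (h : LinearMap.ker f ≤ LinearMap.ker f') :
    ∃ g : I →ₗ[R] I', ∀ n, g (f n) = f' n := by
  obtain ⟨g, hg⟩ := hI'.out (LinearMap.range f).subtype (Submodule.subtype_injective _)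
    ((LinearMap.ker f).liftQ f' h ∘ₗ f.quotKerEquivRange.symm.toLinearMap)
  refine ⟨g, fun n => ?_⟩
  have h1 := hg (f.quotKerEquivRange (Submodule.Quotient.mk n))
  simpa using h1

/-- Essential maps with the same kernel into injective modules have isomorphic targets. -/
theorem exists_equiv_of_essential {N : Type*} {I I' : Type w} [AddCommGroup N] [Module R N]
    [AddCommGroup I] [Module R I] [AddCommGroup I'] [Module R I'] [hI : Module.Injective R I]
    [hI' : Module.Injective R I'] (f : N →ₗ[R] I) (f' : N →ₗ[R] I')
    (h : LinearMap.ker f = LinearMap.ker f')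
    (hf : ∀ U : Submodule R I, U ⊓ LinearMap.range f = ⊥ → U = ⊥)
    (hf' : ∀ U : Submodule R I', U ⊓ LinearMap.range f' = ⊥ → U = ⊥) :
    ∃ e : I ≃ₗ[R] I', ∀ n, e (f n) = f' n := by
  obtain ⟨g, hg⟩ := exists_extension_of_ker_le f f' h.le
  -- Equality of kernels makes `g` injective on the range of `f`, which is essential.
  have hk : LinearMap.ker g = ⊥ := by
    refine hf _ (eq_bot_iff.2 ?_)
    rintro _ ⟨hm, n, rfl⟩
    have : n ∈ LinearMap.ker f' := by
      rw [LinearMap.mem_ker, ← hg]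
      exact hm
    rw [← h] at this
    exact this
  have hinj : Function.Injective g := LinearMap.ker_eq_bot.1 hk
  -- The retraction `r` is injective on the essential range of `f'`, hence injective; a retraction
  -- that is injective forces `g` to be onto.
  obtain ⟨r, hr⟩ := hI.out g hinj LinearMap.id
  have hkr : LinearMap.ker r = ⊥ := by
    refine hf' _ (eq_bot_iff.2 ?_)
    rintro _ ⟨hm, n, rfl⟩
    have h0 : f n = 0 := by
      have := hr (f n)
      rw [hg] at this
      exact this.symm.trans hm
    rw [← hg, h0, map_zero]
    exact zero_mem _
  have hsurj : Function.Surjective g := fun m =>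
    ⟨r m, LinearMap.ker_eq_bot.1 hkr (hr (r m))⟩
  exact ⟨LinearEquiv.ofBijective g ⟨hinj, hsurj⟩, hg⟩

/-- The terms of a minimal injective coresolution are unique up to isomorphism. -/
theorem MinInjCoresolution.nonempty_equiv {M : Type w} [AddCommGroup M] [Module R M]
    (C C' : MinInjCoresolution R M) (i : ℕ) : Nonempty (C.I i ≃ₗ[R] C'.I i) := by
  have hC := C.injective
  have hC' := C'.injective
  -- The commuting square is carried along because it matches the images of the `i`-th
  -- differentials, hence the kernels of the next ones.
  suffices H : ∀ i, ∃ (e : C.I i ≃ₗ[R] C'.I i) (e' : C.I (i + 1) ≃ₗ[R] C'.I (i + 1)),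
      ∀ m, e' (C.d i m) = C'.d i (e m) from ⟨(H i).choose⟩
  intro i
  induction i with
  | zero =>
    obtain ⟨e, he⟩ := exists_equiv_of_essential C.ι C'.ι
      (by rw [LinearMap.ker_eq_bot.2 C.ι_injective, LinearMap.ker_eq_bot.2 C'.ι_injective])
      C.essential_zero C'.essential_zero
    obtain ⟨e', he'⟩ := exists_equiv_of_essential (C.d 0) (C'.d 0 ∘ₗ e.toLinearMap) (by
        ext m
        simp only [LinearMap.mem_ker, LinearMap.comp_apply, LinearEquiv.coe_coe]
        rw [C.exact_zero m, C'.exact_zero (e m)]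
        simp only [Set.mem_range, ← he, e.injective.eq_iff]) (C.essential_succ 0)
      (by
        intro U hU
        rw [LinearMap.range_comp_of_range_eq_top _ (LinearEquiv.range e)] at hU
        exact C'.essential_succ 0 U hU)
    exact ⟨e, e', he'⟩
  | succ i ih =>
    obtain ⟨e₀, e, he⟩ := ih
    obtain ⟨e', he'⟩ := exists_equiv_of_essential (C.d (i + 1))
      (C'.d (i + 1) ∘ₗ e.toLinearMap) (by
        ext m
        simp only [LinearMap.mem_ker, LinearMap.comp_apply, LinearEquiv.coe_coe]
        rw [C.exact_succ i m, C'.exact_succ i (e m)]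
        constructor
        · rintro ⟨n, rfl⟩
          exact ⟨e₀ n, (he n).symm⟩
        · rintro ⟨n, hn⟩
          refine ⟨e₀.symm n, e.injective ?_⟩
          rw [he, e₀.apply_symm_apply, hn]) (C.essential_succ (i + 1))
      (by
        intro U hU
        rw [LinearMap.range_comp_of_range_eq_top _ (LinearEquiv.range e)] at hU
        exact C'.essential_succ (i + 1) U hU)
    exact ⟨e, e', he'⟩

theorem HasMultiplicity.of_equiv {X : Type v} [AddCommGroup X] [Module R X] {M M' : Type w}
    [AddCommGroup M] [Module R M] [AddCommGroup M'] [Module R M'] (e : M ≃ₗ[R] M') {n : ℕ}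
    (h : HasMultiplicity R X M n) : HasMultiplicity R X M' n := by
  have key : ∀ {M M' : Type w} [AddCommGroup M] [Module R M] [AddCommGroup M'] [Module R M']
      (_ : M ≃ₗ[R] M') (k : ℕ),
      (∃ N N' : Submodule R M, IsCompl N N' ∧ Nonempty (N ≃ₗ[R] (Fin k → X))) →
      ∃ N N' : Submodule R M', IsCompl N N' ∧ Nonempty (N ≃ₗ[R] (Fin k → X)) := by
    rintro M M' _ _ _ _ e k ⟨N, N', hc, ⟨f⟩⟩
    refine ⟨N.map e.toLinearMap, N'.map e.toLinearMap, ?_, ⟨(e.submoduleMap N).symm.trans f⟩⟩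
    exact (Submodule.orderIsoMapComap e).isCompl hc
  exact ⟨key e n h.1, fun k hk => h.2 (key e.symm k hk)⟩

theorem exists_isCompl_of_leftInverse {X M : Type*} [AddCommGroup X] [Module R X]
    [AddCommGroup M] [Module R M] (f : X →ₗ[R] M) (g : M →ₗ[R] X)
    (h : ∀ m, g (f m) = m) :
    ∃ N N' : Submodule R M, IsCompl N N' ∧ Nonempty (N ≃ₗ[R] X) := by
  have hf : Function.Injective f := Function.LeftInverse.injective h
  refine ⟨LinearMap.range f, LinearMap.ker g, ?_, ⟨(LinearEquiv.ofInjective f hf).symm⟩⟩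
  have := LinearMap.isCompl_of_proj (p := LinearMap.range f)
    (f := f.rangeRestrict ∘ₗ g) (by
      rintro ⟨_, n, rfl⟩
      ext
      simp [h])
  rwa [LinearMap.ker_comp_of_ker_eq_bot] at this
  rw [LinearMap.ker_rangeRestrict, LinearMap.ker_eq_bot.2 hf]

end Modules

/-! ### Augmented cochains of a simplex and the cone contraction. -/

section Cochains

variable (K : Type u) [Field K] {α : Type v} (r : α → ℕ)

/-- The incidence sign of the facet of `T` opposite to `t`, for the order on the vertices given by
`r`. -/
def facetSign (t : α) (T : Finset α) : K := (-1) ^ (T.filter fun s => r s < r t).card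

theorem facetSign_mul_self (t : α) (T : Finset α) :
    facetSign K r t T * facetSign K r t T = 1 := by
  rw [facetSign, ← mul_pow]
  simp

variable {r} [DecidableEq α]

/-- Removing the smaller vertex flips the sign of the larger one; removing the larger leaves the
sign of the smaller unchanged. -/
theorem facetSign_anticomm (hr : Function.Injective r) {s t : α} {T : Finset α} (hs : s ∈ T)
    (ht : t ∈ T) (hst : s ≠ t) :
    facetSign K r t T * facetSign K r s (T.erase t) =
      -(facetSign K r s T * facetSign K r t (T.erase s)) := by
  have key : ∀ {s t : α}, s ∈ T → t ∈ T → r s < r t →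
      facetSign K r t T = -facetSign K r t (T.erase s) ∧
        facetSign K r s (T.erase t) = facetSign K r s T := by
    intro s t hs ht h
    constructor
    · rw [facetSign, facetSign, Finset.filter_erase,
        ← Finset.card_erase_add_one (s := T.filter fun a => r a < r t) (a := s)
          (by simp [hs, h]), pow_succ]
      ring
    · rw [facetSign, facetSign, Finset.filter_erase, Finset.erase_eq_of_notMem]
      simp [h.le]
  rcases lt_or_gt_of_ne (hr.ne hst) with h | h
  · obtain ⟨h1, h2⟩ := key hs ht h
    rw [h1, h2]; ring
  · obtain ⟨h1, h2⟩ := key ht hs h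
    rw [h1, h2]; ring

variable (r)

/-- The simplicial coboundary on functions on finite sets, placed in degree given by the
cardinality. -/
def coboundary (c : Finset α → K) (T : Finset α) : K :=
  ∑ t ∈ T, facetSign K r t T * c (T.erase t)

/-- The contraction of the coboundary given by the cone over `p`. -/
def coneHomotopy (p : α) (c : Finset α → K) (S : Finset α) : K :=
  if p ∈ S then 0 else facetSign K r p (insert p S) * c (insert p S)

variable {r}

theorem coboundary_coboundary (hr : Function.Injective r) (c : Finset α → K) (T : Finset α) :
    coboundary K r (coboundary K r c) T = 0 := by
  unfold coboundary
  simp only [Finset.mul_sum]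
  rw [Finset.sum_sigma']
  refine Finset.sum_involution (fun a _ => ⟨a.2, a.1⟩) ?_ ?_ ?_ ?_
  · rintro ⟨t, s⟩ h
    simp only [Finset.mem_sigma, Finset.mem_erase] at h
    rw [Finset.erase_right_comm (a := s) (b := t), ← mul_assoc, ← mul_assoc,
      facetSign_anticomm K hr h.2.2 h.1 h.2.1]
    ring
  · rintro ⟨t, s⟩ h _ h'
    simp only [Finset.mem_sigma, Finset.mem_erase] at h
    simp only [Sigma.mk.injEq] at h'
    exact h.2.1 h'.1
  · rintro ⟨t, s⟩ h
    simp only [Finset.mem_sigma, Finset.mem_erase] at h ⊢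
    exact ⟨h.2.2, Ne.symm h.2.1, h.1⟩
  · rintro ⟨t, s⟩ h
    rfl

/-- The empty set counts as a face, so the identity has no correction term in the lowest degree. For
`p ∉ S`, the terms for facets opposite to `t ≠ p` cancel in pairs by anticommutation of signs. -/
theorem coneHomotopy_coboundary (hr : Function.Injective r) (p : α) (c : Finset α → K)
    (S : Finset α) :
    coboundary K r (coneHomotopy K r p c) S + coneHomotopy K r p (coboundary K r c) S = c S := by
  by_cases hp : p ∈ S
  · rw [coneHomotopy, if_pos hp, add_zero, coboundary, Finset.sum_eq_single_of_mem p hp]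
    · rw [coneHomotopy, if_neg (Finset.notMem_erase p S), Finset.insert_erase hp, ← mul_assoc,
        facetSign_mul_self, one_mul]
    · intro t _ htp
      rw [coneHomotopy, if_pos (Finset.mem_erase.2 ⟨htp.symm, hp⟩), mul_zero]
  · rw [coneHomotopy, if_neg hp, coboundary, coboundary, Finset.sum_insert hp, mul_add,
      ← mul_assoc, facetSign_mul_self, one_mul, Finset.erase_insert hp, add_left_comm,
      add_eq_left, Finset.mul_sum, ← Finset.sum_add_distrib]
    refine Finset.sum_eq_zero fun t ht => ?_
    have htp : t ≠ p := fun h => hp (h ▸ ht)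
    have h1 := facetSign_anticomm K hr (Finset.mem_insert_self p S)
      (Finset.mem_insert_of_mem ht (b := p)) htp.symm
    have h3 := facetSign_mul_self K r p ((insert p S).erase t)
    have h4 := facetSign_mul_self K r p (insert p S)
    rw [Finset.erase_insert hp] at h1
    rw [coneHomotopy, if_neg fun h => hp (Finset.mem_of_mem_erase h),
      ← Finset.erase_insert_of_ne htp.symm]
    generalize facetSign K r p ((insert p S).erase t) = a at *
    generalize facetSign K r p (insert p S) = b at *
    generalize facetSign K r t (insert p S) = f at *
    generalize facetSign K r t S = g at *
    generalize c ((insert p S).erase t) = z at *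
    have : g * a = - (b * f) := by
      calc g * a = b * (b * g) * a := by rw [← mul_assoc b b, h4, one_mul]
        _ = - (b * f) * (a * a) := by rw [← neg_eq_iff_eq_neg.2 h1]; ring
        _ = _ := by rw [h3, mul_one]
    rw [← mul_assoc, this]; ring

end Cochains

end BassNumbers

noncomputable section

namespace BassNumbers

open MulOpposite

/-! ### Coordinates on the modules `I(x)` and their injectivity. -/

section Coordinates

variable (K : Type u) [Field K] {L : Type v} [PartialOrder L]

/-- The basis element `p^w_x` of the incidence algebra, or `0` if `w ≤ x` fails. -/
def matUnit (w x : L) : IncidenceAlgebra K L :=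
  open Classical in
  { toFun := fun a b => if a = w ∧ b = x ∧ w ≤ x then 1 else 0
    eq_zero_of_not_le' := fun a b h => if_neg fun hx => h (by rw [hx.1, hx.2.1]; exact hx.2.2) }

open Classical in
theorem matUnit_apply (w x a b : L) :
    matUnit K w x a b = if a = w ∧ b = x ∧ w ≤ x then 1 else 0 := rfl

theorem idem_apply [DecidableEq L] (x a b : L) :
    idem K x a b = if a = x ∧ b = x then 1 else 0 := rfl

variable {K} [LocallyFiniteOrder L]

theorem incidence_mul_apply [Fintype L] (f g : IncidenceAlgebra K L) (a b : L) :
    (f * g) a b = ∑ c, f a c * g c b := by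
  rw [IncidenceAlgebra.mul_apply]
  refine Finset.sum_subset (Finset.subset_univ _) fun c _ hc => ?_
  rw [Finset.mem_Icc, not_and_or] at hc
  rcases hc with h | h
  · rw [IncidenceAlgebra.apply_eq_zero_of_not_le h, zero_mul]
  · rw [IncidenceAlgebra.apply_eq_zero_of_not_le h, mul_zero]

variable [DecidableEq L]

theorem mul_idem_apply [Fintype L] (f : IncidenceAlgebra K L) (x a b : L) :
    (f * idem K x) a b = if b = x then f a x else 0 := by
  rw [incidence_mul_apply]
  simp only [idem_apply]
  split_ifs with h <;> simp [h]

theorem idem_mul_apply [Fintype L] (f : IncidenceAlgebra K L) (x a b : L) :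
    (idem K x * f) a b = if a = x then f x b else 0 := by
  rw [incidence_mul_apply]
  simp only [idem_apply]
  split_ifs with h <;> simp [h]

theorem mem_leftIdeal_iff [Fintype L] (x : L) (f : IncidenceAlgebra K L) :
    f ∈ leftIdeal K x ↔ ∀ a b, b ≠ x → f a b = 0 := by
  rw [leftIdeal, Ideal.mem_span_singleton']
  constructor
  · rintro ⟨g, rfl⟩ a b h
    rw [mul_idem_apply, if_neg h]
  · intro h
    refine ⟨f, IncidenceAlgebra.ext fun a b _ => ?_⟩
    rw [mul_idem_apply]
    split_ifs with hb
    · rw [hb]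
    · rw [h a b hb]

theorem mem_projModule_iff [Fintype L] (x : L) (f : IncidenceAlgebra K L) :
    f ∈ projModule K x ↔ ∀ a b, a ≠ x → f a b = 0 := by
  rw [projModule, Submodule.mem_span_singleton]
  constructor
  · rintro ⟨g, rfl⟩ a b h
    rw [← op_unop g, op_smul_eq_mul, idem_mul_apply, if_neg h]
  · intro h
    refine ⟨op f, IncidenceAlgebra.ext fun a b _ => ?_⟩
    rw [op_smul_eq_mul, idem_mul_apply]
    split_ifs with hb
    · rw [hb]
    · rw [h a b hb]

variable (K) in
/-- The basis element `p^w_x` of `A e_x`, or `0` if `w ≤ x` fails. -/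
def colUnit [Fintype L] (w x : L) : leftIdeal K x :=
  ⟨matUnit K w x, (mem_leftIdeal_iff x _).2 fun _ _ h => if_neg fun h' => h h'.2.1⟩

theorem colUnit_of_not_le [Fintype L] {w x : L} (h : ¬ w ≤ x) : colUnit K w x = 0 :=
  Subtype.ext (IncidenceAlgebra.ext fun _ _ _ => if_neg fun h' => h h'.2.2)

theorem leftIdeal_eq_sum [Fintype L] {x : L} (m : leftIdeal K x) :
    m = ∑ w, m.1 w x • colUnit K w x := by
  refine Subtype.ext (IncidenceAlgebra.ext fun a b _ => ?_)
  have hs : ((∑ w, m.1 w x • colUnit K w x : leftIdeal K x) : IncidenceAlgebra K L) a b =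
      ∑ w, m.1 w x * matUnit K w x a b := by
    let ev : leftIdeal K x →ₗ[K] K :=
      { toFun := fun m => m.1 a b, map_add' := fun _ _ => rfl, map_smul' := fun _ _ => rfl }
    change ev _ = _
    rw [map_sum]
    rfl
  rw [hs, Finset.sum_eq_single a]
  · rw [matUnit_apply]
    by_cases hb : b = x
    · subst hb
      by_cases hab : a ≤ b
      · simp [hab]
      · simp [hab, IncidenceAlgebra.apply_eq_zero_of_not_le hab]
    · rw [(mem_leftIdeal_iff x _).1 m.2 a b hb, if_neg (fun h => hb h.2.1), mul_zero]
  · intro w _ hw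
    rw [matUnit_apply, if_neg (fun h => hw h.1.symm), mul_zero]
  · simp

theorem leftIdeal_map_eq_sum [Fintype L] {x : L} (φ : leftIdeal K x →ₗ[K] K)
    (m : leftIdeal K x) : φ m = ∑ w, m.1 w x * φ (colUnit K w x) := by
  conv_lhs => rw [leftIdeal_eq_sum m, map_sum]
  exact Finset.sum_congr rfl fun w _ => map_smul φ _ _

namespace InjModule

variable [Fintype L] {x : L}

/-- The values of a functional on the basis of `A e_x`, extended by `0`. -/
def coord (φ : InjModule K x) (w : L) : K :=
  DFunLike.coe (F := leftIdeal K x →ₗ[K] K) φ (colUnit K w x)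

variable (x) in
/-- The functional with prescribed values on the basis of `A e_x`. -/
def ofCoord (g : L → K) : InjModule K x :=
  show leftIdeal K x →ₗ[K] K from
  { toFun := fun m => ∑ w, g w * m.1 w x
    map_add' := fun m m' => by
      rw [← Finset.sum_add_distrib]
      exact Finset.sum_congr rfl fun w _ => mul_add _ _ _
    map_smul' := fun c m => by
      rw [RingHom.id_apply, smul_eq_mul, Finset.mul_sum]
      exact Finset.sum_congr rfl fun w _ => mul_left_comm _ c _ }

theorem coord_of_not_le (φ : InjModule K x) {w : L} (h : ¬ w ≤ x) : φ.coord w = 0 := by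
  rw [coord, colUnit_of_not_le h]
  exact LinearMap.map_zero _

open Classical in
theorem coord_ofCoord (g : L → K) (w : L) :
    (ofCoord x g).coord w = if w ≤ x then g w else 0 := by
  split_ifs with h
  · change ∑ v, g v * matUnit K w x v x = g w
    rw [Finset.sum_eq_single w]
    · simp [matUnit_apply, h]
    · intro v _ hv
      simp [matUnit_apply, hv]
    · simp
  · exact coord_of_not_le _ h

theorem ext_coord {φ ψ : InjModule K x} (h : ∀ w, w ≤ x → φ.coord w = ψ.coord w) : φ = ψ := by
  refine LinearMap.ext (σ := RingHom.id K) fun m => ?_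
  refine (leftIdeal_map_eq_sum φ m).trans (Eq.trans ?_ (leftIdeal_map_eq_sum ψ m).symm)
  refine Finset.sum_congr rfl fun w _ => congrArg (m.1 w x * ·) ?_
  by_cases hw : w ≤ x
  · exact h w hw
  · exact (coord_of_not_le φ hw).trans (coord_of_not_le ψ hw).symm

@[simp] theorem coord_zero (w : L) : (0 : InjModule K x).coord w = 0 := rfl

@[simp] theorem coord_add (φ ψ : InjModule K x) (w : L) :
    (φ + ψ).coord w = φ.coord w + ψ.coord w := rfl

theorem coord_smul (a : (IncidenceAlgebra K L)ᵐᵒᵖ) (φ : InjModule K x) {w : L} (h : w ≤ x) :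
    (a • φ).coord w = ∑ v, φ.coord v * unop a v w := by
  refine (leftIdeal_map_eq_sum φ (unop a • colUnit K w x)).trans ?_
  refine Finset.sum_congr rfl fun v _ => ?_
  rw [mul_comm]
  refine congrArg (φ.coord v * ·) ?_
  change (unop a * matUnit K w x) v x = _
  rw [incidence_mul_apply, Finset.sum_eq_single w]
  · simp [matUnit_apply, h]
  · intro c _ hc
    simp [matUnit_apply, hc]
  · simp

/-- The action of a scalar of the base field. -/
theorem coord_smul_scalar (c : K) (φ : InjModule K x) (w : L) :
    (op (c • (1 : IncidenceAlgebra K L)) • φ).coord w = c * φ.coord w := by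
  by_cases h : w ≤ x
  · rw [coord_smul _ _ h, Finset.sum_eq_single w]
    · simp [mul_comm]
    · intro v _ hv
      simp [hv]
    · simp
  · rw [coord_of_not_le _ h, coord_of_not_le _ h, mul_zero]

open Classical in
theorem coord_matUnit_smul {v w : L} (hvw : v ≤ w) (φ : InjModule K x) (u : L) :
    (op (matUnit K v w) • φ).coord u = if u = w ∧ w ≤ x then φ.coord v else 0 := by
  by_cases h : u ≤ x
  · rw [coord_smul _ _ h, Finset.sum_eq_single v]
    · by_cases hu : u = w
      · subst hu; simp [matUnit_apply, hvw, h]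
      · simp [matUnit_apply, hu]
    · intro v' _ hv
      simp [matUnit_apply, hv]
    · simp
  · rw [coord_of_not_le _ h, if_neg]
    rintro ⟨rfl, h'⟩
    exact h h'

/-- Baer's criterion: a module map into `I(x)` is determined by its coordinate at `x`, a `K`-linear
functional, and functionals extend over a field. -/
instance : Module.Injective (IncidenceAlgebra K L)ᵐᵒᵖ (InjModule K x) := by
  refine Module.Baer.injective fun I g => ?_
  have hsc : ∀ (c : K) (r : (IncidenceAlgebra K L)ᵐᵒᵖ),
      c • r = op (c • (1 : IncidenceAlgebra K L)) • r := by
    intro c r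
    apply unop_injective
    rw [smul_eq_mul, unop_mul, unop_smul, unop_op, mul_smul_comm, mul_one]
  let IK : Submodule K (IncidenceAlgebra K L)ᵐᵒᵖ :=
    { carrier := I
      add_mem' := I.add_mem
      zero_mem' := I.zero_mem
      smul_mem' := fun c r hr => by
        rw [hsc]
        exact I.smul_mem _ hr }
  let f : IK →ₗ[K] K :=
    { toFun := fun m => (g ⟨m.1, m.2⟩).coord x
      map_add' := fun m m' => by
        rw [← coord_add, ← map_add]
        rfl
      map_smul' := fun c m => by
        rw [RingHom.id_apply, smul_eq_mul, ← coord_smul_scalar, ← map_smul]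
        congr 2
        exact Subtype.ext (hsc c m.1) }
  obtain ⟨F, hF⟩ := f.exists_extend
  have hF' : ∀ m (hm : m ∈ I), F m = (g ⟨m, hm⟩).coord x := fun m hm =>
    LinearMap.congr_fun hF ⟨m, hm⟩
  -- The image of `1` is forced: its coordinate at `w` is the coordinate at `x` after acting by
  -- `p^w_x`.
  refine ⟨LinearMap.toSpanSingleton _ _ (ofCoord x fun w => F (op (matUnit K w x))), ?_⟩
  intro m hm
  refine ext_coord fun w hw => ?_
  rw [LinearMap.toSpanSingleton_apply, coord_smul _ _ hw]
  have h1 : (g ⟨m, hm⟩).coord w = F (op (matUnit K w x) * m) := by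
    rw [hF' _ (I.mul_mem_left _ hm)]
    have : (⟨op (matUnit K w x) * m, I.mul_mem_left _ hm⟩ : I) =
      op (matUnit K w x) • (⟨m, hm⟩ : I) := rfl
    rw [this, map_smul, coord_matUnit_smul hw, if_pos ⟨rfl, le_rfl⟩]
  have h2 : op (matUnit K w x) * m = ∑ v, (unop m v w) • op (matUnit K v x) := by
    apply unop_injective
    rw [unop_mul, unop_op]
    have hm' : unop m * matUnit K w x ∈ leftIdeal K x :=
      (leftIdeal K x).mul_mem_left _ (colUnit K w x).2
    have := congrArg Subtype.val (leftIdeal_eq_sum ⟨_, hm'⟩)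
    dsimp only at this
    rw [this]
    rw [Submodule.coe_sum, Finset.unop_sum]
    refine Finset.sum_congr rfl fun v _ => ?_
    rw [unop_smul, unop_op]
    change (unop m * matUnit K w x) v x • matUnit K v x = _
    congr 1
    rw [incidence_mul_apply, Finset.sum_eq_single w]
    · simp [matUnit_apply, hw]
    · intro c _ hc
      simp [matUnit_apply, hc]
    · simp
  rw [h1, h2, map_sum]
  refine Finset.sum_congr rfl fun v _ => ?_
  rw [map_smul, smul_eq_mul, coord_ofCoord, mul_comm]
  split_ifs with hv
  · rfl
  · rw [IncidenceAlgebra.apply_eq_zero_of_not_le (fun h => hv (h.trans hw)), zero_mul, zero_mul]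

end InjModule

end Coordinates

end BassNumbers

end

noncomputable section

namespace BassNumbers

open MulOpposite

/-! ### Multiplicities seen on socles. -/

section Multiplicity

variable {K : Type u} [Field K] {L : Type v} [PartialOrder L] [LocallyFiniteOrder L]
  [DecidableEq L] [Fintype L]

/-- The multiplicity of `I(x)` in a submodule of a product of `I(z t)`, seen on socles. -/
theorem le_card_of_injective {τ : Type*} [Finite τ] (z : τ → L) (x : L) {k : ℕ}
    (f : (Fin k → InjModule K x) →ₗ[(IncidenceAlgebra K L)ᵐᵒᵖ] ∀ t, InjModule K (z t))
    (hf : Function.Injective f) : k ≤ Nat.card {t // z t = x} := by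
  classical
  have := Fintype.ofFinite τ
  -- The socle of `I(x)^k`, the functionals supported at `x`. An embedding restricts to it, and its
  -- image can only meet the factors with `z t = x`.
  let soc : (Fin k → K) → Fin k → InjModule K x := fun c j =>
    InjModule.ofCoord x fun w => if w = x then c j else 0
  have hsoc : ∀ c j w, (soc c j).coord w = if w = x then c j else 0 := by
    intro c j w
    rw [InjModule.coord_ofCoord]
    split_ifs with h1 h2 h2
    · rfl
    · rfl
    · exact absurd h2.le h1
    · rfl
  have soc_add : ∀ c c', soc (c + c') = soc c + soc c' := by
    intro c c'
    refine funext fun j => InjModule.ext_coord fun w _ => ?_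
    rw [Pi.add_apply, InjModule.coord_add, hsoc, hsoc, hsoc]
    split_ifs <;> simp
  have soc_smul : ∀ (a : K) c, soc (a • c) = op (a • (1 : IncidenceAlgebra K L)) • soc c := by
    intro a c
    refine funext fun j => InjModule.ext_coord fun w _ => ?_
    rw [Pi.smul_apply, InjModule.coord_smul_scalar, hsoc, hsoc]
    split_ifs <;> simp
  let F : (Fin k → K) →ₗ[K] ({t // z t = x} → K) :=
    { toFun := fun c t => (f (soc c) t.1).coord x
      map_add' := fun c c' => by
        ext t
        rw [soc_add, map_add]
        rfl
      map_smul' := fun a c => by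
        ext t
        rw [soc_smul, map_smul, Pi.smul_apply, InjModule.coord_smul_scalar]
        rfl }
  have hF : Function.Injective F := by
    refine (injective_iff_map_eq_zero F).2 fun c hc => ?_
    have h0 : f (soc c) = 0 := by
      refine funext fun t => InjModule.ext_coord fun w hw => ?_
      rw [Pi.zero_apply, InjModule.coord_zero]
      by_cases hwx : w = x
      · subst hwx
        by_cases ht : z t = w
        · exact congrFun hc ⟨t, ht⟩
        -- Here `w < z t`, so `p^w_{z t}` annihilates the source, while in `I(z t)` it carries the
        -- coordinate at `w` to the one at `z t`.
        · have h1 : op (matUnit K w (z t)) • soc c = 0 := by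
            refine funext fun j => InjModule.ext_coord fun u hu => ?_
            rw [Pi.smul_apply, InjModule.coord_matUnit_smul hw, if_neg]
            · rfl
            · rintro ⟨_, h2⟩
              exact ht (le_antisymm h2 hw)
          have h2 : (f (op (matUnit K w (z t)) • soc c) t).coord (z t) = 0 := by
            rw [h1, map_zero]
            rfl
          rwa [map_smul, Pi.smul_apply, InjModule.coord_matUnit_smul hw,
            if_pos ⟨rfl, le_rfl⟩] at h2
      · have h1 : op (matUnit K w w) • soc c = 0 := by
          refine funext fun j => InjModule.ext_coord fun u hu => ?_
          rw [Pi.smul_apply, InjModule.coord_matUnit_smul le_rfl, hsoc, if_neg hwx, ite_self]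
          rfl
        have h2 : (f (op (matUnit K w w) • soc c) t).coord w = 0 := by
          rw [h1, map_zero]
          rfl
        rwa [map_smul, Pi.smul_apply, InjModule.coord_matUnit_smul le_rfl,
          if_pos ⟨rfl, hw⟩] at h2
    have h1 : soc c = 0 := hf (h0.trans (map_zero f).symm)
    refine funext fun j => ?_
    have := hsoc c j x
    rw [h1, if_pos rfl] at this
    exact this.symm
  have := LinearMap.finrank_le_finrank_of_injective hF
  rwa [Module.finrank_fin_fun, Module.finrank_fintype_fun_eq_card, ← Nat.card_eq_fintype_card]
    at this

theorem hasMultiplicity_pi {τ : Type*} [Finite τ] (z : τ → L) (x : L) :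
    HasMultiplicity (IncidenceAlgebra K L)ᵐᵒᵖ (InjModule K x) (∀ t, InjModule K (z t))
      (Nat.card {t // z t = x}) := by
  classical
  constructor
  · let σ : {t // z t = x} ≃ Fin (Nat.card {t // z t = x}) := Finite.equivFin _
    let e : ∀ t : {t // z t = x},
        InjModule K x ≃ₗ[(IncidenceAlgebra K L)ᵐᵒᵖ] InjModule K (z t.1) := fun t =>
      (congrArg (fun u => InjModule K x ≃ₗ[(IncidenceAlgebra K L)ᵐᵒᵖ] InjModule K u) t.2.symm).mp
        (LinearEquiv.refl _ _)
    refine exists_isCompl_of_leftInverse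
      (LinearMap.pi fun t => if h : z t = x then
        (e ⟨t, h⟩).toLinearMap ∘ₗ LinearMap.proj (σ ⟨t, h⟩) else 0)
      (LinearMap.pi fun j => (e (σ.symm j)).symm.toLinearMap ∘ₗ LinearMap.proj (σ.symm j).1) ?_
    intro m
    refine funext fun j => ?_
    rw [LinearMap.pi_apply, LinearMap.comp_apply, LinearMap.proj_apply, LinearMap.pi_apply,
      dif_pos (σ.symm j).2]
    simp
  · rintro k ⟨N, N', -, ⟨f⟩⟩
    exact le_card_of_injective z x (N.subtype ∘ₗ f.symm.toLinearMap)
      (N.injective_subtype.comp f.symm.injective)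

end Multiplicity

/-! ### The explicit coresolution. -/

section Coresolution

variable {P : Type v} [PartialOrder P]

/-- The largest order ideal that is disjoint from `S`. -/
def avoid (S : Finset P) : LowerSet P := (upperClosure (S : Set P)).compl

theorem le_avoid_iff {S : Finset P} {w : LowerSet P} : w ≤ avoid S ↔ ∀ s ∈ S, s ∉ w := by
  constructor
  · intro h s hs hw
    exact h hw (subset_upperClosure hs)
  · intro h p hp hp'
    obtain ⟨s, hs, hsp⟩ := mem_upperClosure.1 hp'
    exact h s hs (w.lower hsp hp)

theorem avoid_anti {S T : Finset P} (h : S ⊆ T) : avoid T ≤ avoid S :=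
  le_avoid_iff.2 fun s hs => le_avoid_iff.1 le_rfl s (h hs)

theorem isAntichain_maxSet (X : Set P) : IsAntichain (· ≤ ·) (maxSet X) :=
  setOfPred_maximal_antichain _

theorem avoid_eq_iff {S : Finset P} (hS : IsAntichain (· ≤ ·) (S : Set P)) [Finite P]
    {x : LowerSet P} : avoid S = x ↔ (S : Set P) = minSet ((x : Set P)ᶜ) := by
  constructor
  · rintro rfl
    have h1 : ((avoid S : LowerSet P) : Set P)ᶜ = upperClosure (S : Set P) := compl_compl _
    rw [h1]
    ext p
    constructor
    · intro hp
      refine ⟨subset_upperClosure hp, fun q hq hqp => ?_⟩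
      obtain ⟨s, hs, hsq⟩ := mem_upperClosure.1 hq
      rwa [← hS.eq hs hp (hsq.trans hqp)]
    · intro hp
      obtain ⟨s, hs, hsp⟩ := mem_upperClosure.1 hp.1
      rwa [← le_antisymm hsp (hp.2 (subset_upperClosure hs) hsp)]
  · intro h
    refine le_antisymm (fun p hp => ?_) (le_avoid_iff.2 fun s hs => ?_)
    · by_contra hpx
      obtain ⟨m, hm, hmin⟩ := (Set.toFinite ((x : Set P)ᶜ)).exists_le_minimal hpx
      have : m ∈ (S : Set P) := h ▸ hmin
      exact hp (mem_upperClosure.2 ⟨m, this, hm⟩)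
    · have : s ∈ minSet ((x : Set P)ᶜ) := h ▸ hs
      exact this.1

/-- This identifies the `w` at which the simplex on `max(y) \ w` is empty. -/
theorem le_iff_maxSet_subset [Finite P] {y w : LowerSet P} :
    y ≤ w ↔ maxSet (y : Set P) ⊆ w := by
  constructor
  · intro h p hp
    exact h hp.1
  · intro h p hp
    obtain ⟨m, hm, hmax⟩ := (Set.toFinite (y : Set P)).exists_le_maximal hp
    exact w.lower hm (h hmax)

/-- The conditions for a coordinate to be present. -/
def IsCoord (i : ℕ) (Y w : LowerSet P) (S : Finset P) : Prop :=
  ((S : Set P) ⊆ maxSet (Y : Set P) ∧ S.card = i) ∧ w ≤ avoid S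

/-- The coordinates at `w` are closed under passing to facets, so truncation by `Term.ofCoord` never
alters a term of a coboundary. -/
theorem IsCoord.erase [DecidableEq P] {i : ℕ} {Y w : LowerSet P} {T : Finset P}
    (h : IsCoord (i + 1) Y w T) {t : P} (ht : t ∈ T) : IsCoord i Y w (T.erase t) :=
  ⟨⟨fun _ hs => h.1.1 (Finset.mem_of_mem_erase hs),
    by rw [Finset.card_erase_of_mem ht, h.1.2, Nat.add_sub_cancel]⟩,
    h.2.trans (avoid_anti (Finset.erase_subset t T))⟩

theorem isCoord_zero_iff {Y w : LowerSet P} {S : Finset P} : IsCoord 0 Y w S ↔ S = ∅ := by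
  constructor
  · intro h
    exact Finset.card_eq_zero.1 h.1.2
  · rintro rfl
    exact ⟨by simp, le_avoid_iff.2 (by simp)⟩

variable {J : Type v} (y : J → LowerSet P)

/-- The index set of the indecomposable summands in degree `i` of the minimal injective
coresolution of the direct sum of the `P(y j)`. -/
abbrev Face (i : ℕ) : Type v :=
  {s : J × Finset P // (s.2 : Set P) ⊆ maxSet (y s.1 : Set P) ∧ s.2.card = i}

variable (K : Type u) [Field K] [LocallyFiniteOrder (LowerSet P)] [DecidableEq (LowerSet P)]

/-- The degree `i` term of the minimal injective coresolution of the direct sum of the `P(y j)`. -/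
abbrev Term (i : ℕ) : Type (max u v) := ∀ s : Face y i, InjModule K (avoid s.1.2)

variable [Fintype (LowerSet P)] {K} {y} {i : ℕ}

open Classical in
/-- The coordinates of an element of a term, extended by `0`. -/
def Term.coord (c : Term y K i) (j : J) (w : LowerSet P) (S : Finset P) : K :=
  if h : (S : Set P) ⊆ maxSet (y j : Set P) ∧ S.card = i then (c ⟨(j, S), h⟩).coord w else 0

variable (y i) in
/-- The element of a term with prescribed coordinates. -/
def Term.ofCoord (g : J → LowerSet P → Finset P → K) : Term y K i := fun s =>
  InjModule.ofCoord _ fun w => g s.1.1 w s.1.2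

open Classical in
theorem Term.coord_ofCoord (g : J → LowerSet P → Finset P → K) (j : J) (w : LowerSet P)
    (S : Finset P) :
    (Term.ofCoord y i g).coord j w S = if IsCoord i (y j) w S then g j w S else 0 := by
  unfold Term.coord IsCoord Term.ofCoord
  by_cases h : (S : Set P) ⊆ maxSet (y j : Set P) ∧ S.card = i
  · rw [dif_pos h, InjModule.coord_ofCoord]
    simp [h]
  · rw [dif_neg h, if_neg fun h' => h h'.1]

theorem Term.coord_eq_zero (c : Term y K i) {j : J} {w : LowerSet P} {S : Finset P}
    (h : ¬ IsCoord i (y j) w S) : c.coord j w S = 0 := by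
  unfold Term.coord
  split_ifs with h'
  · exact InjModule.coord_of_not_le _ fun h'' => h ⟨h', h''⟩
  · rfl

theorem Term.ext_coord {c c' : Term y K i}
    (h : ∀ j w S, IsCoord i (y j) w S → c.coord j w S = c'.coord j w S) : c = c' := by
  refine funext fun s => InjModule.ext_coord fun w hw => ?_
  have := h s.1.1 w s.1.2 ⟨s.2, hw⟩
  rwa [Term.coord, Term.coord, dif_pos s.2, dif_pos s.2] at this

theorem Term.coord_zero (j : J) (w : LowerSet P) (S : Finset P) :
    (0 : Term y K i).coord j w S = 0 := by
  unfold Term.coord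
  split_ifs <;> rfl

theorem Term.coord_add (c c' : Term y K i) (j : J) (w : LowerSet P) (S : Finset P) :
    (c + c').coord j w S = c.coord j w S + c'.coord j w S := by
  unfold Term.coord
  split_ifs
  · rfl
  · simp

theorem Term.coord_smul (a : (IncidenceAlgebra K (LowerSet P))ᵐᵒᵖ) (c : Term y K i) {j : J}
    {w : LowerSet P} {S : Finset P} (h : w ≤ avoid S) :
    (a • c).coord j w S = ∑ v, c.coord j v S * unop a v w := by
  unfold Term.coord
  split_ifs
  · exact InjModule.coord_smul _ _ h
  · simp

open Classical in
theorem Term.coord_matUnit_smul {v w : LowerSet P} (hvw : v ≤ w) (c : Term y K i) (j : J)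
    (u : LowerSet P) (S : Finset P) :
    (op (matUnit K v w) • c).coord j u S = if u = w ∧ w ≤ avoid S then c.coord j v S else 0 := by
  unfold Term.coord
  split_ifs with h h' h'
  · exact (InjModule.coord_matUnit_smul hvw _ _).trans (if_pos h')
  · exact (InjModule.coord_matUnit_smul hvw _ _).trans (if_neg h')
  · rfl
  · rfl

variable (y K) in
/-- The rows `y j` of a matrix, as an element of the degree `0` term. -/
def coaugmentation :
    IncidenceAlgebra K (LowerSet P) →ₗ[(IncidenceAlgebra K (LowerSet P))ᵐᵒᵖ] Term y K 0 where
  toFun f := Term.ofCoord y 0 fun j w _ => f (y j) w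
  map_add' f g := by
    refine Term.ext_coord fun j w T hT => ?_
    rw [Term.coord_add, Term.coord_ofCoord, Term.coord_ofCoord, Term.coord_ofCoord, if_pos hT,
      if_pos hT, if_pos hT]
    rfl
  map_smul' a f := by
    refine Term.ext_coord fun j w T hT => ?_
    rw [RingHom.id_apply, Term.coord_smul _ _ hT.2, Term.coord_ofCoord, if_pos hT, ← op_unop a,
      op_smul_eq_mul, incidence_mul_apply]
    refine Finset.sum_congr rfl fun v _ => ?_
    rw [Term.coord_ofCoord]
    by_cases hv : v ≤ w
    · rw [if_pos ⟨hT.1, hv.trans hT.2⟩, unop_op]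
    · simp [IncidenceAlgebra.apply_eq_zero_of_not_le hv]

theorem coord_coaugmentation (f : IncidenceAlgebra K (LowerSet P)) (j : J) (w : LowerSet P) :
    (coaugmentation y K f).coord j w ∅ = f (y j) w :=
  (Term.coord_ofCoord _ _ _ _).trans (if_pos (isCoord_zero_iff.2 rfl))

variable (y K) [DecidableEq P] (r : P → ℕ)

/-- The differential of the coresolution. -/
def differential (i : ℕ) :
    Term y K i →ₗ[(IncidenceAlgebra K (LowerSet P))ᵐᵒᵖ] Term y K (i + 1) where
  toFun c := Term.ofCoord y (i + 1) fun j w => coboundary K r (c.coord j w)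
  map_add' c c' := by
    refine Term.ext_coord fun j w T hT => ?_
    rw [Term.coord_add, Term.coord_ofCoord, Term.coord_ofCoord, Term.coord_ofCoord, if_pos hT,
      if_pos hT, if_pos hT]
    simp only [coboundary, Term.coord_add, mul_add, Finset.sum_add_distrib]
  map_smul' a c := by
    refine Term.ext_coord fun j w T hT => ?_
    rw [RingHom.id_apply, Term.coord_smul _ _ hT.2, Term.coord_ofCoord, if_pos hT, coboundary]
    have h1 : ∀ t ∈ T, facetSign K r t T * (a • c).coord j w (T.erase t) =
        ∑ v, facetSign K r t T * c.coord j v (T.erase t) * unop a v w := by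
      intro t ht
      rw [Term.coord_smul _ _ (hT.erase ht).2, Finset.mul_sum]
      exact Finset.sum_congr rfl fun v _ => (mul_assoc _ _ _).symm
    rw [Finset.sum_congr rfl h1, Finset.sum_comm]
    refine Finset.sum_congr rfl fun v _ => ?_
    rw [Term.coord_ofCoord]
    -- Truncation can only affect the coordinates at `v ≰ w`, and there the matrix entry of `a`
    -- vanishes.
    by_cases hv : v ≤ w
    · rw [if_pos ⟨hT.1, hv.trans hT.2⟩, coboundary, Finset.sum_mul]
    · simp [IncidenceAlgebra.apply_eq_zero_of_not_le hv]

variable {y K r}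

open Classical in
theorem coord_differential (c : Term y K i) (j : J) (w : LowerSet P) (T : Finset P) :
    (differential y K r i c).coord j w T =
      if IsCoord (i + 1) (y j) w T then coboundary K r (c.coord j w) T else 0 :=
  Term.coord_ofCoord _ _ _ _

theorem mem_ker_differential {c : Term y K i} :
    differential y K r i c = 0 ↔
      ∀ j w T, IsCoord (i + 1) (y j) w T → coboundary K r (c.coord j w) T = 0 := by
  constructor
  · intro h j w T hT
    have := coord_differential (r := r) c j w T
    rwa [h, Term.coord_zero, if_pos hT, eq_comm] at this
  · intro h
    refine Term.ext_coord fun j w T hT => ?_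
    rw [coord_differential, if_pos hT, Term.coord_zero, h j w T hT]

/-- A cocycle is a coboundary at every `w` for which the simplex is nonempty. -/
theorem eq_coboundary_coneHomotopy (hr : Function.Injective r) {c : Term y K i}
    (hc : differential y K r i c = 0) {j : J} {w : LowerSet P} {p : P}
    (hp : p ∈ maxSet (y j : Set P)) (hpw : p ∉ w) {S : Finset P} (hS : IsCoord i (y j) w S) :
    coboundary K r (coneHomotopy K r p (c.coord j w)) S = c.coord j w S := by
  have h := coneHomotopy_coboundary K hr p (c.coord j w) S
  rwa [coneHomotopy, ite_eq_left_iff.2, add_zero] at h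
  intro hpS
  rw [mem_ker_differential.1 hc, mul_zero]
  refine ⟨⟨?_, by rw [Finset.card_insert_of_notMem hpS, hS.1.2]⟩, le_avoid_iff.2 ?_⟩
  · rw [Finset.coe_insert]
    exact Set.insert_subset hp hS.1.1
  · intro s hs
    rcases Finset.mem_insert.1 hs with rfl | hs
    · exact hpw
    · exact le_avoid_iff.1 hS.2 s hs

theorem differential_exact (hr : Function.Injective r) (i : ℕ) :
    Function.Exact (differential y K r i) (differential y K r (i + 1)) := by
  classical
  intro c
  constructor
  · intro hc
    -- The cone vertex may be chosen separately for each `j` and `w`: only a preimage of one element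
    -- is needed, so no linearity over the algebra is required.
    let b : J → LowerSet P → Finset P → K := fun j w =>
      if h : ∃ p, p ∈ maxSet (y j : Set P) ∧ p ∉ w then
        coneHomotopy K r h.choose (c.coord j w) else 0
    refine ⟨Term.ofCoord y i b, Term.ext_coord fun j w T hT => ?_⟩
    rw [coord_differential, if_pos hT]
    have h1 : coboundary K r ((Term.ofCoord y i b).coord j w) T = coboundary K r (b j w) T := by
      refine Finset.sum_congr rfl fun t ht => ?_
      rw [Term.coord_ofCoord, if_pos (hT.erase ht)]
    have hne : ∃ p, p ∈ maxSet (y j : Set P) ∧ p ∉ w := by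
      obtain ⟨p, hp⟩ := Finset.card_pos.1 (by rw [hT.1.2]; exact i.succ_pos)
      exact ⟨p, hT.1.1 hp, le_avoid_iff.1 hT.2 p hp⟩
    rw [h1, show b j w = _ from dif_pos hne]
    exact eq_coboundary_coneHomotopy hr hc hne.choose_spec.1 hne.choose_spec.2 hT
  · rintro ⟨b, rfl⟩
    rw [mem_ker_differential]
    intro j w T hT
    rw [← coboundary_coboundary K hr (b.coord j w) T]
    refine Finset.sum_congr rfl fun t ht => ?_
    rw [coord_differential, if_pos (hT.erase ht)]

/-- A nonzero submodule contains a nonzero element supported on socles, and the differential kills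
socles. By exactness this gives all the essentiality conditions of a minimal coresolution. -/
theorem ker_differential_essential [Finite J] [Finite P]
    (N : Submodule (IncidenceAlgebra K (LowerSet P))ᵐᵒᵖ (Term y K i))
    (hN : N ⊓ LinearMap.ker (differential y K r i) = ⊥) : N = ⊥ := by
  classical
  by_contra hne
  obtain ⟨m₀, hm₀, hm₀'⟩ := N.exists_mem_ne_zero_of_ne_bot hne
  let W : Set (LowerSet P) := {w | ∃ m ∈ N, ∃ j S, m.coord j w S ≠ 0}
  have hW : W.Nonempty := by
    by_contra h
    refine hm₀' (Term.ext_coord fun j w S _ => ?_)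
    rw [Term.coord_zero]
    by_contra h'
    exact h ⟨w, m₀, hm₀, j, S, h'⟩
  -- The action moves coordinates upwards, so at a maximal `w` every nonzero coordinate of `m` lies
  -- in a socle: otherwise `p^w_{avoid S}` would move it higher.
  obtain ⟨w, hw⟩ := (Set.toFinite W).exists_maximal hW
  obtain ⟨m, hm, j, S, hne⟩ := hw.1
  have hS : IsCoord i (y j) w S := by
    by_contra h
    exact hne (m.coord_eq_zero h)
  have hsoc : ∀ j S, m.coord j w S ≠ 0 → avoid S = w := by
    intro j S h
    have hS : IsCoord i (y j) w S := by
      by_contra h'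
      exact h (m.coord_eq_zero h')
    refine le_antisymm (hw.2 ⟨op (matUnit K w (avoid S)) • m, N.smul_mem _ hm, j, S, ?_⟩ hS.2) hS.2
    rwa [Term.coord_matUnit_smul hS.2, if_pos ⟨rfl, le_rfl⟩]
  have hmem : op (matUnit K w w) • m ∈ N ⊓ LinearMap.ker (differential y K r i) := by
    refine ⟨N.smul_mem _ hm, mem_ker_differential.2 fun j u T hT => ?_⟩
    refine Finset.sum_eq_zero fun t ht => ?_
    rw [Term.coord_matUnit_smul le_rfl]
    split_ifs with h
    · obtain ⟨rfl, -⟩ := h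
      by_cases h0 : m.coord j u (T.erase t) = 0
      · rw [h0, mul_zero]
      · exfalso
        -- Otherwise `t` would belong to the ideal `avoid (T.erase t) = u`, which is disjoint from
        -- `T`. The conclusion puts `t` above another element of the antichain `max(y j)`.
        have htu : t ∈ upperClosure ((T.erase t : Finset P) : Set P) := by
          by_contra h'
          exact le_avoid_iff.1 hT.2 t ht ((hsoc j _ h0).le h')
        obtain ⟨s, hs, hst⟩ := mem_upperClosure.1 htu
        rw [Finset.mem_coe, Finset.mem_erase] at hs
        exact hs.1 ((isAntichain_maxSet _).eq (hT.1.1 hs.2) (hT.1.1 ht) hst)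
    · rw [mul_zero]
  rw [hN, Submodule.mem_bot] at hmem
  have h1 : (op (matUnit K w w) • m).coord j w S = m.coord j w S := by
    rw [Term.coord_matUnit_smul le_rfl, if_pos ⟨rfl, hS.2⟩]
  rw [hmem, Term.coord_zero] at h1
  exact hne h1.symm

/-- The kernel in degree `0` is the sum of the `P(y j)`: the cone kills coordinates where the
simplex is nonempty, and where it is empty there is no condition. -/
theorem differential_zero_eq_zero_iff (hr : Function.Injective r) [Finite P] {c : Term y K 0} :
    differential y K r 0 c = 0 ↔ ∀ j w, ¬ y j ≤ w → c.coord j w ∅ = 0 := by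
  constructor
  · intro hc j w hw
    rw [le_iff_maxSet_subset, Set.not_subset] at hw
    obtain ⟨p, hp, hpw⟩ := hw
    rw [← eq_coboundary_coneHomotopy hr hc hp hpw (isCoord_zero_iff.2 rfl)]
    rfl
  · intro h
    refine mem_ker_differential.2 fun j w T hT => Finset.sum_eq_zero fun t ht => ?_
    rw [isCoord_zero_iff.1 (hT.erase ht), h, mul_zero]
    intro hw
    exact le_avoid_iff.1 hT.2 t ht (le_iff_maxSet_subset.1 hw (hT.1.1 ht))

/-- The explicit minimal injective coresolution of a module that is isomorphic to the direct sum of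
the `P(y j)`. -/
def minInjCoresolution [Finite J] [Finite P] (hr : Function.Injective r) {M : Type (max u v)}
    [AddCommGroup M] [Module (IncidenceAlgebra K (LowerSet P))ᵐᵒᵖ M]
    (ι : M →ₗ[(IncidenceAlgebra K (LowerSet P))ᵐᵒᵖ] Term y K 0) (hι : Function.Injective ι)
    (h0 : Function.Exact ι (differential y K r 0)) :
    MinInjCoresolution (IncidenceAlgebra K (LowerSet P))ᵐᵒᵖ M where
  I := Term y K
  ι := ι
  d := differential y K r
  injective _ := inferInstance
  ι_injective := hι
  exact_zero := h0
  exact_succ := differential_exact hr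
  essential_zero N hN := by
    rw [← LinearMap.exact_iff.1 h0] at hN
    exact ker_differential_essential N hN
  essential_succ i N hN := by
    rw [← LinearMap.exact_iff.1 (differential_exact hr i)] at hN
    exact ker_differential_essential N hN

end Coresolution

end BassNumbers

end

namespace BassNumbers

/-! ### Counting summands. -/

section Main

variable {P : Type v} [PartialOrder P]

/-- The order ideals covering `x` are the `x ∪ {p}` with `p` minimal in the complement of `x`. -/
theorem ncard_cov [Finite P] (x : LowerSet P) :
    (cov x).ncard = (minSet ((x : Set P)ᶜ)).ncard := by
  let F : ∀ p ∈ minSet ((x : Set P)ᶜ), LowerSet P := fun p hp =>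
    ⟨insert p (x : Set P), by
      rintro a b hba (rfl | ha)
      · by_cases hb : b ∈ x
        · exact Or.inr hb
        · exact Or.inl (le_antisymm hba (hp.2 hb hba))
      · exact Or.inr (x.lower hba ha)⟩
  have hF : ∀ p hp q, q ∈ F p hp ↔ q = p ∨ q ∈ x := fun _ _ _ => Iff.rfl
  have hlt : ∀ p hp, x < F p hp := fun p hp =>
    lt_of_le_not_ge (fun q hq => Or.inr hq) fun h => hp.1 (h (Or.inl rfl))
  refine (Set.ncard_congr F ?_ ?_ ?_).symm
  · intro p hp
    refine ⟨hlt p hp, fun c hxc hc => hc.not_ge ?_⟩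
    obtain ⟨q, hq, hqx⟩ := Set.not_subset.1 hxc.not_ge
    have hqp : q = p := ((hF p hp q).1 (hc.le hq)).resolve_right hqx
    rintro s (rfl | hs)
    · exact hqp ▸ hq
    · exact hxc.le hs
  · intro p q hp hq h
    have : p ∈ F q hq := h ▸ Or.inl rfl
    exact ((hF q hq p).1 this).resolve_right hp.1
  · intro z hz
    obtain ⟨q, hq, hqx⟩ := Set.not_subset.1 hz.1.not_ge
    obtain ⟨p, hpq, hp⟩ := (Set.toFinite ((x : Set P)ᶜ)).exists_le_minimal hqx
    have hle : F p hp ≤ z := by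
      rintro s (rfl | hs)
      · exact z.lower hpq hq
      · exact hz.1.le hs
    exact ⟨p, hp, hle.eq_of_not_lt fun h => hz.2 (hlt p hp) h⟩

-- The equation `avoid S = x` forces `S = min(P \ x)`, so the degree is determined and only the
-- index `j` can vary.
open Classical in
theorem card_face [Finite P] {J : Type v} (y : J → LowerSet P) (x : LowerSet P) (i : ℕ) :
    Nat.card {t : Face y i // avoid t.1.2 = x} =
      if i = (cov x).ncard
        then {j : J | minSet ((x : Set P)ᶜ) ⊆ maxSet (y j : Set P)}.ncard else 0 := by
  have key : ∀ t : {t : Face y i // avoid t.1.2 = x},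
      (t.1.1.2 : Set P) = minSet ((x : Set P)ᶜ) := fun t =>
    (avoid_eq_iff ((isAntichain_maxSet _).subset t.1.2.1)).1 t.2
  split_ifs with hi
  · refine Nat.card_congr (Equiv.ofBijective (fun t => ⟨t.1.1.1, ?_⟩) ⟨?_, ?_⟩)
    · exact (key t).superset.trans t.1.2.1
    · intro t t' h
      have h1 : t.1.1.1 = t'.1.1.1 := congrArg Subtype.val h
      have h2 : t.1.1.2 = t'.1.1.2 := Finset.coe_injective ((key t).trans (key t').symm)
      exact Subtype.ext (Subtype.ext (Prod.ext h1 h2))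
    · rintro ⟨j, hj⟩
      have hfin := Set.toFinite (minSet ((x : Set P)ᶜ))
      have hS : (hfin.toFinset : Set P) = minSet ((x : Set P)ᶜ) := hfin.coe_toFinset
      have hsub : (hfin.toFinset : Set P) ⊆ maxSet (y j : Set P) := hS.subset.trans hj
      refine ⟨⟨⟨(j, hfin.toFinset), hsub, ?_⟩, ?_⟩, rfl⟩
      · rw [hi, ncard_cov, Set.ncard_eq_toFinset_card _ hfin]
      · exact (avoid_eq_iff ((isAntichain_maxSet _).subset hsub)).2 hS
  · have : IsEmpty {t : Face y i // avoid t.1.2 = x} := by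
      refine ⟨fun t => hi ?_⟩
      rw [ncard_cov, ← key t, Set.ncard_coe_finset]
      exact t.1.2.2.symm
    exact Nat.card_of_isEmpty

open Classical in
/-- The Bass numbers of a submodule of the incidence algebra that is the direct sum of the
`P(y j)`. -/
theorem isBassNumber_of_coaugmentation (K : Type u) [Field K] [Finite P]
    [LocallyFiniteOrder (LowerSet P)] [Fintype (LowerSet P)] {J : Type v} [Finite J]
    (y : J → LowerSet P) {M : Type (max u v)} [AddCommGroup M]
    [Module (IncidenceAlgebra K (LowerSet P))ᵐᵒᵖ M]
    (g : M →ₗ[(IncidenceAlgebra K (LowerSet P))ᵐᵒᵖ] IncidenceAlgebra K (LowerSet P))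
    (hinj : ∀ m, (∀ j w, g m (y j) w = 0) → m = 0)
    (hsurj : ∀ f : J → LowerSet P → K, (∀ j w, ¬ y j ≤ w → f j w = 0) →
      ∃ m, ∀ j w, g m (y j) w = f j w) (x : LowerSet P) (i : ℕ) :
    IsBassNumber K i x M (if i = (cov x).ncard
      then {j : J | minSet ((x : Set P)ᶜ) ⊆ maxSet (y j : Set P)}.ncard else 0) := by
  -- Any numbering of the vertices serves for the signs; it need not respect the order of `P`.
  obtain ⟨r, hr⟩ : ∃ r : P → ℕ, Function.Injective r :=
    ⟨fun p => Finite.equivFin P p, Fin.val_injective.comp (Finite.equivFin P).injective⟩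
  have hcoord : ∀ m j w, (coaugmentation y K (g m)).coord j w ∅ = g m (y j) w :=
    fun m j w => coord_coaugmentation (g m) j w
  let C := minInjCoresolution hr (coaugmentation y K ∘ₗ g) (by
    refine (injective_iff_map_eq_zero _).2 fun m hm => hinj m fun j w => ?_
    rw [← hcoord, show coaugmentation y K (g m) = 0 from hm, Term.coord_zero]) (by
    intro c
    rw [differential_zero_eq_zero_iff hr]
    constructor
    · intro hc
      obtain ⟨m, hm⟩ := hsurj (fun j w => c.coord j w ∅) hc
      refine ⟨m, Term.ext_coord fun j w S hS => ?_⟩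
      rw [isCoord_zero_iff.1 hS]
      exact (hcoord m j w).trans (hm j w)
    · rintro ⟨m, rfl⟩ j w hw
      exact (hcoord m j w).trans (IncidenceAlgebra.apply_eq_zero_of_not_le hw _))
  refine ⟨⟨C⟩, fun C' => ?_⟩
  obtain ⟨e⟩ := C.nonempty_equiv C' i
  rw [← card_face y x i]
  have : Finite (Face y i) := inferInstance
  exact (hasMultiplicity_pi (fun s : Face y i => avoid s.1.2) x).of_equiv e

end Main

end BassNumbers

open Classical in
theorem corollary3 (K : Type u) [Field K] (P : Type v) [PartialOrder P] [Finite P]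
    [LocallyFiniteOrder (LowerSet P)] (x : LowerSet P) (i : ℕ) :
    (∀ y : LowerSet P,
      BassNumbers.IsBassNumber K i x (BassNumbers.projModule K y)
        (if i = (BassNumbers.cov x).ncard ∧
            BassNumbers.minSet ((x : Set P)ᶜ) ⊆ BassNumbers.maxSet (y : Set P)
          then 1 else 0)) ∧
    BassNumbers.IsBassNumber K i x (IncidenceAlgebra K (LowerSet P))
      (if i = (BassNumbers.cov x).ncard
        then {y : LowerSet P |
          BassNumbers.minSet ((x : Set P)ᶜ) ⊆ BassNumbers.maxSet (y : Set P)}.ncard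
        else 0) := by
  have := Fintype.ofFinite (LowerSet P)
  constructor
  · intro y
    have h := BassNumbers.isBassNumber_of_coaugmentation K (fun _ : PUnit.{v + 1} => y)
      (BassNumbers.projModule K y).subtype (fun m hm => by
        refine Subtype.ext (IncidenceAlgebra.ext fun a b _ => ?_)
        by_cases ha : a = y
        · rw [ha]
          exact hm PUnit.unit b
        · exact (BassNumbers.mem_projModule_iff y _).1 m.2 a b ha) (fun f hf => by
        refine ⟨⟨⟨fun a b => if a = y then f PUnit.unit b else 0, fun a b hab => ?_⟩,
          (BassNumbers.mem_projModule_iff y _).2 fun a b ha => if_neg ha⟩,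
          fun j w => if_pos rfl⟩
        split_ifs with ha
        · exact hf _ b (ha ▸ hab)
        · rfl) x i
    -- For the one-member family, the set counted is all of `PUnit` or empty.
    convert h using 1
    by_cases h1 : BassNumbers.minSet ((x : Set P)ᶜ) ⊆ BassNumbers.maxSet (y : Set P)
    · simp [h1]
    · simp [h1]
  -- The family of all ideals: a matrix is the collection of its rows.
  · exact BassNumbers.isBassNumber_of_coaugmentation K id LinearMap.id
      (fun m hm => IncidenceAlgebra.ext fun a b _ => hm a b)
      (fun f hf => ⟨⟨f, hf⟩, fun _ _ => rfl⟩) x i
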